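/- Work with categories enriched over the cartesian closed category $\mathrm{Pos}$ of posets and monotone maps: hom-sets are (small) posets and composition is monotone; functors are monotone on hom-sets, and natural transformations are ordered componentwise. Every set is regarded as a discrete poset. For such a category $\mathcal K$ we use the following notions. - A *coinserter* of $u_0,u_1\colon U\to X$ is a morphism $f\colon X\to Y$ with $fu_0\le fu_1$ such that every $f'\colon X\to Y'$ with $f'u_0\le f'u_1$ has the form $f'=gf$ for some $g\colon Y\to Y'$, and such that $gf\le \bar g f$ implies $g\le\bar g$ for all $g,\bar g\colon Y\to Y'$. It is *reflexive* if $u_0d=u_1d=\mathrm{id}_X$ for some $d\colon X\to U$. A *subregular epimorphism* is a coinserter of some parallel pair. - A *prekernel pair* of $f\colon X\to Y$ is a pair $u_0,u_1\colon U\to X$ with $fu_0\le fu_1$ such that every pair $v_0,v_1\colon V\to X$ with $fv_0\le fv_1$ has the form $v_i=u_ik$ ($i=0,1$) for some $k\colon V\to U$, and such that $u_ik\le u_i\bar k$ for $i=0,1$ implies $k\le\bar k$, for all $k,\bar k\colon V\to U$. - A *tensor* $P\otimes G$ of an object $G$ with a poset $P$ is an object with order-isomorphisms $\mathrm{Pos}(P,\mathcal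 K(G,X))\cong\mathcal K(P\otimes G,X)$ natural in $X$. - $G$ is *abstractly finite* if $P\otimes G$ exists for every poset $P$, and every morphism $G\to P\otimes G$ factorizes through $m\otimes G\colon Q\otimes G\to P\otimes G$ for some finite subposet $m\colon Q\hookrightarrow P$. - $G$ is *subregularly projective* if for every subregular epimorphism $e\colon X\to Y$ every morphism $G\to Y$ factorizes through $e$. - $G$ is a *strong generator* if (in the ordinary sense) it has all small copowers and for every object $X$ there is an epimorphism from some copower of $G$ to $X$ that does not factorize through any proper subobject of $X$. - A *colimit of $D\colon\mathcal D\to\mathcal K$ weighted by $W\colon\mathcal D^{\mathrm{op}}\to\mathrm{Pos}$* is an object $C$ with order-isomorphisms $\mathcal K(C,X)\cong[\mathcal D^{\mathrm{op}},\mathrm{Pos}](W,\mathcal K(D-,X))$ natural in $X$; a *limit of $D$ weighted by $W\colon\mathcal D\to\mathrm{Pos}$* is an object $L$ with order-isomorphisms $\mathcal K(X,L)\cong[\mathcal D,\mathrm{Pos}](W,\mathcal K(X,D-))$ natural in $X$. **Proposition.** Let $\mathcal K$ be a category with prekernel pairs and reflexive coinserters, and let $G$ be an abstractly finite, subregularly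 projective strong generator of $\mathcal K$. Then $\mathcal K$ has all weighted limits and all weighted colimits (over small $\mathcal D$). Moreover, if $\mathcal A$ denotes the full subcategory on chosen finite copowers $\coprod_n G$, $n\in\mathbb N$, then the functor $\mathcal K\to[\mathcal A^{\mathrm{op}},\mathrm{Pos}]$ sending $X$ to the restriction of $\mathcal K(-,X)$ is (in the enriched sense) fully faithful and has a left adjoint; thus $\mathcal K$ is equivalent to a full reflective subcategory of $[\mathcal A^{\mathrm{op}},\mathrm{Pos}]$. -/

import Mathlib

open CategoryTheory CategoryTheory.Limits Opposite

universe w v u v₁ u₁ v₂ u₂ v₃ u₃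

/-! ## Categories enriched over posets -/

/-- A category enriched over the cartesian closed category of posets: every hom-set is partially
ordered, and composition is monotone (in both variables). -/
class PosEnriched (C : Type u) [Category.{v} C] where
  homOrder : ∀ X Y : C, PartialOrder (X ⟶ Y)
  comp_le_comp : ∀ {X Y Z : C} {f f' : X ⟶ Y} {g g' : Y ⟶ Z},
    f ≤ f' → g ≤ g' → f ≫ g ≤ f' ≫ g'

attribute [reducible, instance] PosEnriched.homOrder

namespace PosEnriched

/-- The category of posets, with the pointwise order of monotone maps. -/
instance instPartOrd : PosEnriched PartOrd.{w} where
  homOrder X Y := PartialOrder.lift (fun f : X ⟶ Y => f.hom) (fun _ _ h => PartOrd.hom_ext h)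
  comp_le_comp {_ _ _ _ f' g _} hf hg := fun x =>
    le_trans (g.hom.monotone (hf x)) (hg (f'.hom x))

/-- The dual of an enriched category; the order of the hom-sets is kept. -/
instance instOpposite (C : Type u) [Category.{v} C] [PosEnriched C] : PosEnriched Cᵒᵖ where
  homOrder X Y := PartialOrder.lift (fun f : X ⟶ Y => f.unop) (fun _ _ h => Quiver.Hom.unop_inj h)
  comp_le_comp hf hg := PosEnriched.comp_le_comp (C := C) hg hf

/-- A full subcategory (given by a family of objects), with the induced order on hom-sets. -/
instance instInduced {I : Type u₁} {C : Type u} [Category.{v} C] [PosEnriched C] (T : I → C) :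
    PosEnriched (InducedCategory C T) where
  homOrder X Y := PartialOrder.lift (fun f : X ⟶ Y => f.hom)
    (fun _ _ h => InducedCategory.Hom.ext h)
  comp_le_comp hf hg := PosEnriched.comp_le_comp (C := C) hf hg

end PosEnriched

/-- An enriched functor: a functor that is monotone on hom-sets. -/
structure PosFunctor (C : Type u₁) [Category.{v₁} C] [PosEnriched C]
    (D : Type u₂) [Category.{v₂} D] [PosEnriched D] extends C ⥤ D where
  map_mono : ∀ {X Y : C} {f g : X ⟶ Y}, f ≤ g → map f ≤ map g

namespace PosFunctor

section

variable {C : Type u₁} [Category.{v₁} C] [PosEnriched C]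
  {D : Type u₂} [Category.{v₂} D] [PosEnriched D]
  {E : Type u₃} [Category.{v₃} E] [PosEnriched E]

/-- The functor category `[C, D]`: enriched functors and natural transformations. -/
instance instCategory : Category.{max u₁ v₂} (PosFunctor C D) where
  Hom F G := NatTrans F.toFunctor G.toFunctor
  id F := NatTrans.id F.toFunctor
  comp α β := NatTrans.vcomp α β

/-- Natural transformations are ordered componentwise. -/
instance instPosEnriched : PosEnriched (PosFunctor C D) where
  homOrder F G := PartialOrder.lift
    (fun (α : NatTrans F.toFunctor G.toFunctor) (X : C) => α.app X)
    (fun _ _ h => NatTrans.ext h)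
  comp_le_comp hα hβ := fun X => PosEnriched.comp_le_comp (hα X) (hβ X)

/-- The dual of an enriched functor. -/
def op (F : PosFunctor C D) : PosFunctor Cᵒᵖ Dᵒᵖ where
  toFunctor := F.toFunctor.op
  map_mono h := F.map_mono h

/-- The composite `G ∘ F` of enriched functors. -/
def comp (F : PosFunctor C D) (G : PosFunctor D E) : PosFunctor C E where
  toFunctor := F.toFunctor ⋙ G.toFunctor
  map_mono h := G.map_mono (F.map_mono h)

/-- Fully faithful in the enriched sense: every map `C(X, Y) → D(F X, F Y)` is an isomorphism
of posets. -/
def IsFullyFaithful (F : PosFunctor C D) : Prop :=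
  ∀ X Y : C, Function.Bijective (fun f : X ⟶ Y => F.map f) ∧
    ∀ f g : X ⟶ Y, F.map f ≤ F.map g → f ≤ g

/-- `F` has an enriched left adjoint `L`: isomorphisms of posets `C(L Y, X) ≅ D(Y, F X)`, natural
in `X` and in `Y`. -/
def HasLeftAdjoint (F : PosFunctor C D) : Prop :=
  ∃ (L : PosFunctor D C) (e : ∀ (Y : D) (X : C), (L.obj Y ⟶ X) ≃o (Y ⟶ F.obj X)),
    (∀ (Y : D) (X X' : C) (f : L.obj Y ⟶ X) (h : X ⟶ X'), e Y X' (f ≫ h) = e Y X f ≫ F.map h) ∧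
    (∀ (Y Y' : D) (X : C) (k : Y' ⟶ Y) (f : L.obj Y ⟶ X), e Y' X (L.map k ≫ f) = k ≫ e Y X f)

end

/-- The hom-functor `C(K, -) : C → Pos`. -/
def homFrom {C : Type u} [Category.{v} C] [PosEnriched C] (K : C) : PosFunctor C PartOrd.{v} where
  obj X := PartOrd.of (K ⟶ X)
  map h := PartOrd.ofHom ⟨fun f => f ≫ h, fun _ _ hf => PosEnriched.comp_le_comp hf le_rfl⟩
  map_id X := by ext f; exact Category.comp_id f
  map_comp h k := by ext f; exact (Category.assoc f h k).symm
  map_mono hle := fun (f : K ⟶ _) => PosEnriched.comp_le_comp (le_refl f) hle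

/-- The hom-functor `C(-, K) : Cᵒᵖ → Pos`. -/
def homTo {C : Type u} [Category.{v} C] [PosEnriched C] (K : C) : PosFunctor Cᵒᵖ PartOrd.{v} where
  obj X := PartOrd.of (X.unop ⟶ K)
  map h := PartOrd.ofHom ⟨fun f => h.unop ≫ f, fun _ _ hf => PosEnriched.comp_le_comp le_rfl hf⟩
  map_id X := by ext f; exact Category.id_comp f
  map_comp h k := by ext f; exact Category.assoc k.unop h.unop f
  map_mono {X Y _ _} hle := fun (f : X.unop ⟶ K) =>
    PosEnriched.comp_le_comp (C := C) hle (le_refl f)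

section

variable {D : Type u₁} [Category.{v₁} D] [PosEnriched D]
  {C : Type u} [Category.{v} C] [PosEnriched C]

/-- For `F : D → C`, the functor `C → [Dᵒᵖ, Pos]` given by `X ↦ C(F -, X)`. -/
def nerve (F : PosFunctor D C) : PosFunctor C (PosFunctor Dᵒᵖ PartOrd.{v}) where
  obj X := F.op.comp (homTo X)
  map h :=
    { app := fun d => (homFrom (F.obj d.unop)).map h
      naturality := fun d d' k => by
        ext f; exact Category.assoc (F.map k.unop) f h }
  map_id X := NatTrans.ext (funext fun d => (homFrom (F.obj d.unop)).map_id X)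
  map_comp h k := NatTrans.ext (funext fun d => (homFrom (F.obj d.unop)).map_comp h k)
  map_mono hle := fun d => (homFrom (F.obj d.unop)).map_mono hle

/-- For `F : D → C`, the functor `Cᵒᵖ → [D, Pos]` given by `X ↦ C(X, F -)`. -/
def conerve (F : PosFunctor D C) : PosFunctor Cᵒᵖ (PosFunctor D PartOrd.{v}) where
  obj X := F.comp (homFrom X.unop)
  map h :=
    { app := fun d => (homTo (F.obj d)).map h
      naturality := fun d d' k => by
        ext f; exact (Category.assoc h.unop f (F.map k)).symm }
  map_id X := NatTrans.ext (funext fun d => (homTo (F.obj d)).map_id X)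
  map_comp h k := NatTrans.ext (funext fun d => (homTo (F.obj d)).map_comp h k)
  map_mono hle := fun d => (homTo (F.obj d)).map_mono hle

end

/-- The embedding of the full subcategory on a family of objects. -/
def inclusion {I : Type u₁} {C : Type u} [Category.{v} C] [PosEnriched C] (T : I → C) :
    PosFunctor (InducedCategory C T) C where
  toFunctor := inducedFunctor T
  map_mono h := h

end PosFunctor

/-! ## Weighted limits and colimits -/

section

variable {D : Type u₁} [Category.{v₁} D] [PosEnriched D]
  {C : Type u} [Category.{v} C] [PosEnriched C]

/-- A colimit of `F : D → C` weighted by `W : Dᵒᵖ → Pos`: an object `pt` with isomorphisms of posets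
`C(pt, X) ≅ [Dᵒᵖ, Pos](W, C(F -, X))`, natural in `X`. -/
structure WeightedColimit (F : PosFunctor D C) (W : PosFunctor Dᵒᵖ PartOrd.{v}) where
  pt : C
  iso : ∀ X : C, (pt ⟶ X) ≃o (W ⟶ F.nerve.obj X)
  natural : ∀ {X X' : C} (f : pt ⟶ X) (h : X ⟶ X'), iso X' (f ≫ h) = iso X f ≫ F.nerve.map h

/-- A limit of `F : D → C` weighted by `W : D → Pos`: an object `pt` with isomorphisms of posets
`C(X, pt) ≅ [D, Pos](W, C(X, F -))`, natural in `X`. -/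
structure WeightedLimit (F : PosFunctor D C) (W : PosFunctor D PartOrd.{v}) where
  pt : C
  iso : ∀ X : C, (X ⟶ pt) ≃o (W ⟶ F.conerve.obj (op X))
  natural : ∀ {X X' : C} (f : X ⟶ pt) (h : X' ⟶ X),
    iso X' (h ≫ f) = iso X f ≫ F.conerve.map h.op

end

/-- All (small) weighted colimits exist. -/
def HasWeightedColimits (C : Type u) [Category.{v} C] [PosEnriched C] : Prop :=
  ∀ (D : Type v) [Category.{v} D] [PosEnriched D] (F : PosFunctor D C)
    (W : PosFunctor Dᵒᵖ PartOrd.{v}), Nonempty (WeightedColimit F W)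

/-- All (small) weighted limits exist. -/
def HasWeightedLimits (C : Type u) [Category.{v} C] [PosEnriched C] : Prop :=
  ∀ (D : Type v) [Category.{v} D] [PosEnriched D] (F : PosFunctor D C)
    (W : PosFunctor D PartOrd.{v}), Nonempty (WeightedLimit F W)

/-! ## Coinserters, prekernel pairs, tensors and generators -/

section

variable {C : Type u} [Category.{v} C] [PosEnriched C]

/-- `f` is a coinserter of the pair `u₀, u₁`: it is universal with respect to `f u₀ ≤ f u₁`. -/
structure IsCoinserter {U X Y : C} (u₀ u₁ : U ⟶ X) (f : X ⟶ Y) : Prop where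
  condition : u₀ ≫ f ≤ u₁ ≫ f
  exists_desc : ∀ {Y' : C} (f' : X ⟶ Y'), u₀ ≫ f' ≤ u₁ ≫ f' → ∃ g : Y ⟶ Y', f ≫ g = f'
  le_of_comp_le : ∀ {Y' : C} (g g' : Y ⟶ Y'), f ≫ g ≤ f ≫ g' → g ≤ g'

/-- A subregular epimorphism is a coinserter of some parallel pair. -/
def IsSubregularEpi {X Y : C} (f : X ⟶ Y) : Prop :=
  ∃ (U : C) (u₀ u₁ : U ⟶ X), IsCoinserter u₀ u₁ f

/-- `u₀, u₁` is a prekernel pair of `f`: it is universal with respect to `f u₀ ≤ f u₁`. -/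
structure IsPrekernelPair {U X Y : C} (f : X ⟶ Y) (u₀ u₁ : U ⟶ X) : Prop where
  condition : u₀ ≫ f ≤ u₁ ≫ f
  exists_lift : ∀ {V : C} (v₀ v₁ : V ⟶ X), v₀ ≫ f ≤ v₁ ≫ f →
    ∃ k : V ⟶ U, k ≫ u₀ = v₀ ∧ k ≫ u₁ = v₁
  le_of_comp_le : ∀ {V : C} (k k' : V ⟶ U), k ≫ u₀ ≤ k' ≫ u₀ → k ≫ u₁ ≤ k' ≫ u₁ → k ≤ k'

variable (C) in
/-- Every morphism has a prekernel pair. -/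
def HasPrekernelPairs : Prop :=
  ∀ {X Y : C} (f : X ⟶ Y), ∃ (U : C) (u₀ u₁ : U ⟶ X), IsPrekernelPair f u₀ u₁

variable (C) in
/-- Every reflexive pair (two split epimorphisms with a joint splitting) has a coinserter. -/
def HasReflexiveCoinserters : Prop :=
  ∀ {U X : C} (u₀ u₁ : U ⟶ X), IsReflexivePair u₀ u₁ →
    ∃ (Y : C) (f : X ⟶ Y), IsCoinserter u₀ u₁ f

/-- A tensor `P ⊗ K` of the object `K` with the poset `P`: an object `pt` with isomorphisms of posets
`Pos(P, C(K, X)) ≅ C(pt, X)`, natural in `X`. -/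
structure PosTensor (P : Type v) [PartialOrder P] (K : C) where
  pt : C
  iso : ∀ X : C, (P →o (K ⟶ X)) ≃o (pt ⟶ X)
  natural : ∀ {X X' : C} (f : P →o (K ⟶ X)) (h : X ⟶ X'),
    iso X' (OrderHom.comp ⟨fun k => k ≫ h, fun _ _ hk => PosEnriched.comp_le_comp hk le_rfl⟩ f) =
      iso X f ≫ h

namespace PosTensor

/-- The unit `P → C(K, P ⊗ K)`, which corresponds to the identity of `P ⊗ K`. -/
def unit {P : Type v} [PartialOrder P] {K : C} (T : PosTensor P K) : P →o (K ⟶ T.pt) :=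
  (T.iso T.pt).symm (𝟙 T.pt)

/-- The morphism `p ⊗ K : P ⊗ K → Q ⊗ K` for a monotone map `p : P → Q`. -/
def map {P Q : Type v} [PartialOrder P] [PartialOrder Q] {K : C}
    (T : PosTensor P K) (T' : PosTensor Q K) (p : P →o Q) : T.pt ⟶ T'.pt :=
  T.iso T'.pt (T'.unit.comp p)

end PosTensor

/-- `G` is abstractly finite: it has tensors with all posets, and every morphism `G → P ⊗ G`
factorizes through `Q ⊗ G → P ⊗ G` for some finite subposet `Q` of `P`. -/
def IsAbstractlyFinite (G : C) : Prop :=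
  (∀ (P : Type v) [PartialOrder P], Nonempty (PosTensor P G)) ∧
  ∀ (P : Type v) [PartialOrder P] (T : PosTensor P G) (f : G ⟶ T.pt),
    ∃ Q : Set P, Q.Finite ∧ ∃ (S : PosTensor Q G) (g : G ⟶ S.pt),
      g ≫ S.map T (OrderHom.Subtype.val (· ∈ Q)) = f

/-- `G` is subregularly projective: `C(G, -)` takes subregular epimorphisms to surjective maps
(which are the subregular epimorphisms of the category of posets). -/
def IsSubregularlyProjective (G : C) : Prop :=
  ∀ {X Y : C} (e : X ⟶ Y), IsSubregularEpi e → ∀ f : G ⟶ Y, ∃ g : G ⟶ X, g ≫ e = f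

end

/-- `G` is a strong generator (in the ordinary sense): it has all copowers, and every object is an
extremal quotient of a copower of `G`. -/
def IsStrongGeneratorObject {C : Type u} [Category.{v} C] (G : C) : Prop :=
  (∀ A : Type v, HasCoproduct (fun _ : A => G)) ∧
  ∀ X : C, ∃ (A : Type v) (c : Cofan (fun _ : A => G)) (_ : IsColimit c) (e : c.pt ⟶ X),
    ExtremalEpi e

/-!
Say that an element of `X` at stage `G` is a morphism `G ⟶ X`. Strong generation and projectivity
make `K` behave like a category of ordered algebras with these elements, the copowers of `G` being
the free algebras.

*Presentations.* As tensors of `G` with discrete posets exist, the ordinary copowers of `G` are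
enriched. Any morphism factorizes as the coinserter `e` of its prekernel pair followed by some `m`,
and projectivity of `G` shows that `m` is a monomorphism
(`exists_subregular_mono_factorization`). Applied to the canonical morphism to `X` from the copower
of `G` indexed by all elements of `X`, this gives an `m` through which every morphism from a copower
of `G` factorizes, so `m` is invertible, `G` being a strong generator. Hence `X` is the quotient of
that copower by the inequalities between its elements that hold in `X`
(`isCanonicallyPresenting`, `IsCanonicallyPresenting.exists_desc`).

*Limits and colimits.* Given any family of morphisms out of a copower of `G`, the set of all
inequalities between elements that hold in every member of the family is a small reflexive pair; its
coinserter is a joint subregular image of the family (`IsCanonicallyPresenting.exists_jointImage`).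
A weighted limit is the joint image of the projections out of the copower on the set of weighted
cones with vertex `G`. A weighted colimit is the joint image of all weighted cocones, written as
morphisms out of the copower on the elements of the diagram.

*The nerve.* A transformation between nerves on the finite copowers is a monotone map of elements
that commutes with the finitary operations. As every element of a copower of `G` comes from a finite
subcopower, such a map respects the inequalities that present `X` and is induced by a unique
morphism (`exists_nerve_map_eq`). The left adjoint of the nerve takes a presheaf to the weighted
colimit of the inclusion (`PosFunctor.hasLeftAdjoint_nerve`).
-/

/-! ### Monotonicity of composition -/

section

variable {C : Type u} [Category.{v} C] [PosEnriched C]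

lemma comp_le_comp_left {X Y Z : C} (f : X ⟶ Y) {g g' : Y ⟶ Z} (h : g ≤ g') :
    f ≫ g ≤ f ≫ g' :=
  PosEnriched.comp_le_comp le_rfl h

lemma comp_le_comp_right {X Y Z : C} {f f' : X ⟶ Y} (h : f ≤ f') (g : Y ⟶ Z) :
    f ≫ g ≤ f' ≫ g :=
  PosEnriched.comp_le_comp h le_rfl

/-! ### Tensors and enriched copowers -/

namespace PosTensor

variable {P : Type v} [PartialOrder P] {K : C} (T : PosTensor P K)

lemma iso_unit_comp {X : C} (h : T.pt ⟶ X) :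
    T.iso X (OrderHom.comp
      ⟨fun k => k ≫ h, fun _ _ hk => PosEnriched.comp_le_comp hk le_rfl⟩ T.unit) = h := by
  rw [T.natural, unit, OrderIso.apply_symm_apply, Category.id_comp]

lemma unit_comp_iso {X : C} (f : P →o (K ⟶ X)) (p : P) : T.unit p ≫ T.iso X f = f p := by
  have h := (T.iso X).injective (T.iso_unit_comp (T.iso X f))
  exact DFunLike.congr_fun h p

lemma le_of_unit_comp_le {X : C} {g g' : T.pt ⟶ X} (h : ∀ p, T.unit p ≫ g ≤ T.unit p ≫ g') :
    g ≤ g' := by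
  rw [← T.iso_unit_comp g, ← T.iso_unit_comp g']
  exact (T.iso X).monotone h

end PosTensor

/-- The family `ι` exhibits `P` as an enriched copower of `G`: morphisms out of `P` are families of
morphisms out of `G`, ordered componentwise. -/
structure IsCopower {S : Type*} {G P : C} (ι : S → (G ⟶ P)) : Prop where
  exists_desc : ∀ {X : C} (φ : S → (G ⟶ X)), ∃ f : P ⟶ X, ∀ s, ι s ≫ f = φ s
  le_of_comp_le : ∀ {X : C} {f f' : P ⟶ X}, (∀ s, ι s ≫ f ≤ ι s ≫ f') → f ≤ f'

lemma IsCopower.hom_ext {S : Type*} {G P : C} {ι : S → (G ⟶ P)} (hι : IsCopower ι) {X : C}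
    {f f' : P ⟶ X} (h : ∀ s, ι s ≫ f = ι s ≫ f') : f = f' :=
  le_antisymm (hι.le_of_comp_le fun s => (h s).le) (hι.le_of_comp_le fun s => (h s).ge)

/-- A set regarded as a discrete poset. -/
@[reducible]
def discreteOrder (S : Type*) : PartialOrder S where
  le a b := a = b
  le_refl _ := rfl
  le_trans _ _ _ h h' := h.trans h'
  le_antisymm _ _ h _ := h

/-- Over a discrete poset every map is monotone, so the tensor is a copower. -/
lemma PosTensor.isCopower_unit {S : Type v} [PartialOrder S] {G : C} (T : PosTensor S G)
    (hS : ∀ s s' : S, s ≤ s' → s = s') : IsCopower fun s => T.unit s where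
  exists_desc φ := ⟨T.iso _ ⟨φ, fun s s' h => by rw [hS s s' h]⟩, fun s => T.unit_comp_iso _ s⟩
  le_of_comp_le h := T.le_of_unit_comp_le h

lemma IsAbstractlyFinite.exists_isCopower {G : C} (hG : IsAbstractlyFinite G) (S : Type v) :
    ∃ (P : C) (ι : S → (G ⟶ P)), IsCopower ι := by
  let _ := discreteOrder S
  obtain ⟨T⟩ := hG.1 S
  exact ⟨T.pt, _, T.isCopower_unit fun _ _ h => h⟩

lemma exists_isCopower_of_small {G : C}
    (hcop : ∀ S : Type v, ∃ (P : C) (ι : S → (G ⟶ P)), IsCopower ι) (S : Type*) [Small.{v} S] :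
    ∃ (P : C) (ι : S → (G ⟶ P)), IsCopower ι := by
  obtain ⟨P, ι, hι⟩ := hcop (Shrink.{v} S)
  refine ⟨P, fun s => ι (equivShrink S s), fun φ => ?_, fun h => hι.le_of_comp_le fun s => ?_⟩
  · obtain ⟨f, hf⟩ := hι.exists_desc fun s => φ ((equivShrink S).symm s)
    exact ⟨f, fun s => by simp [hf]⟩
  · simpa using h ((equivShrink S).symm s)

/-- An ordinary copower is isomorphic to an enriched one, hence is itself enriched. -/
lemma isCopower_of_isColimit {G : C}
    (hcop : ∀ S : Type v, ∃ (P : C) (ι : S → (G ⟶ P)), IsCopower ι) {S : Type*} [Small.{v} S]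
    {c : Cofan fun _ : S => G} (hc : IsColimit c) : IsCopower c.inj where
  exists_desc φ := ⟨Cofan.IsColimit.desc hc φ, fun s => Cofan.IsColimit.fac hc φ s⟩
  le_of_comp_le {X f f'} h := by
    obtain ⟨P, ι, hι⟩ := exists_isCopower_of_small hcop S
    obtain ⟨u, hu⟩ := hι.exists_desc c.inj
    have hvu : Cofan.IsColimit.desc hc ι ≫ u = 𝟙 c.pt :=
      Cofan.IsColimit.hom_ext hc _ _ fun s => by simp [hu]
    have key : u ≫ f ≤ u ≫ f' := hι.le_of_comp_le fun s => by
      simpa only [← Category.assoc, hu] using h s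
    simpa only [← Category.assoc, hvu, Category.id_comp] using
      comp_le_comp_left (Cofan.IsColimit.desc hc ι) key

/-- Abstract finiteness for copowers: a generalized element of an infinite copower of `G` involves
only finitely many of the summands. -/
lemma IsAbstractlyFinite.exists_isCopower_finite {G : C} (hG : IsAbstractlyFinite G) (S : Type v) :
    ∃ (P : C) (ι : S → (G ⟶ P)), IsCopower ι ∧ ∀ y : G ⟶ P, ∃ (n : ℕ) (q : Fin n → S) (Q : C)
      (κ : Fin n → (G ⟶ Q)) (z : G ⟶ Q) (m : Q ⟶ P),
      IsCopower κ ∧ z ≫ m = y ∧ ∀ i, κ i ≫ m = ι (q i) := by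
  let _ := discreteOrder S
  obtain ⟨T⟩ := hG.1 S
  refine ⟨T.pt, _, T.isCopower_unit fun _ _ h => h, fun y => ?_⟩
  obtain ⟨Q, hQ, T', z, hz⟩ := hG.2 S T y
  have hT' := T'.isCopower_unit fun s s' h => Subtype.ext h
  have := hQ.to_subtype
  obtain ⟨n, ⟨e⟩⟩ := Finite.exists_equiv_fin Q
  refine ⟨n, fun i => e.symm i, T'.pt, fun i => T'.unit (e.symm i), z, _, ⟨fun φ => ?_, ?_⟩, hz,
    fun i => T'.unit_comp_iso _ _⟩
  · obtain ⟨f, hf⟩ := hT'.exists_desc fun s => φ (e s)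
    exact ⟨f, fun i => by simpa using hf (e.symm i)⟩
  · intro X f f' h
    exact hT'.le_of_comp_le fun s => by simpa using h (e s)

/-! ### Subregular epimorphisms and the canonical presentation of an object -/

lemma IsCoinserter.comp_isIso {U X Y Z : C} {u₀ u₁ : U ⟶ X} {f : X ⟶ Y}
    (hf : IsCoinserter u₀ u₁ f) (m : Y ⟶ Z) [IsIso m] : IsCoinserter u₀ u₁ (f ≫ m) where
  condition := by
    simpa only [Category.assoc] using comp_le_comp_right hf.condition m
  exists_desc f' h := by
    obtain ⟨g, hg⟩ := hf.exists_desc f' h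
    exact ⟨inv m ≫ g, by simp [hg]⟩
  le_of_comp_le g g' h := by
    have := hf.le_of_comp_le (m ≫ g) (m ≫ g') (by simpa only [Category.assoc] using h)
    simpa using comp_le_comp_left (inv m) this

lemma IsSubregularEpi.le_of_comp_le {X Y Z : C} {f : X ⟶ Y} (hf : IsSubregularEpi f)
    {g g' : Y ⟶ Z} (h : f ≫ g ≤ f ≫ g') : g ≤ g' := by
  obtain ⟨U, u₀, u₁, hu⟩ := hf
  exact hu.le_of_comp_le g g' h

/-- A morphism `f` factorizes as the coinserter of its prekernel pair followed by a morphism `m`.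
If `G` is projective and separates morphisms, `m` is a monomorphism: elements of the coinserter at
stage `G` lift along the coinserter, and those lifts that `f` puts in order factorize through the
prekernel pair. -/
lemma exists_subregular_mono_factorization (hprekernel : HasPrekernelPairs C)
    (hcoinserter : HasReflexiveCoinserters C) {G : C} (hprojective : IsSubregularlyProjective G)
    (hsep : ∀ {X Y : C} {g g' : X ⟶ Y}, (∀ x : G ⟶ X, x ≫ g = x ≫ g') → g = g')
    {X Y : C} (f : X ⟶ Y) :
    ∃ (Z : C) (e : X ⟶ Z) (m : Z ⟶ Y), IsSubregularEpi e ∧ Mono m ∧ e ≫ m = f := by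
  obtain ⟨U, u₀, u₁, hu⟩ := hprekernel f
  obtain ⟨d, hd₀, hd₁⟩ := hu.exists_lift (𝟙 X) (𝟙 X) le_rfl
  obtain ⟨Z, e, he⟩ := hcoinserter u₀ u₁ (IsReflexivePair.mk' d hd₀ hd₁)
  obtain ⟨m, hm⟩ := he.exists_desc f hu.condition
  refine ⟨Z, e, m, ⟨U, u₀, u₁, he⟩, ⟨fun {V} a b hab => hsep fun x => ?_⟩, hm⟩
  have reflect : ∀ a b : G ⟶ Z, a ≫ m ≤ b ≫ m → a ≤ b := by
    intro a b hab
    obtain ⟨a, rfl⟩ := hprojective e ⟨U, u₀, u₁, he⟩ a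
    obtain ⟨b, rfl⟩ := hprojective e ⟨U, u₀, u₁, he⟩ b
    simp only [Category.assoc, hm] at hab
    obtain ⟨k, rfl, rfl⟩ := hu.exists_lift a b hab
    simpa only [Category.assoc] using comp_le_comp_left k he.condition
  exact le_antisymm (reflect _ _ (by simp [hab])) (reflect _ _ (by simp [hab]))

/-- The consequences of the hypotheses on `G` by which all objects are controlled: `G` has
copowers, is subregularly projective, and for every object `X` the canonical morphism to `X` from
the copower of `G` indexed by the set of morphisms `G ⟶ X` is a subregular epimorphism. -/
structure IsCanonicallyPresenting (G : C) : Prop where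
  exists_isCopower : ∀ S : Type v, ∃ (P : C) (ι : S → (G ⟶ P)), IsCopower ι
  projective : IsSubregularlyProjective G
  isSubregularEpi : ∀ {X P : C} {ι : (G ⟶ X) → (G ⟶ P)}, IsCopower ι →
    ∀ ε : P ⟶ X, (∀ x, ι x ≫ ε = x) → IsSubregularEpi ε

lemma isCanonicallyPresenting (hprekernel : HasPrekernelPairs C)
    (hcoinserter : HasReflexiveCoinserters C) {G : C} (hfinite : IsAbstractlyFinite G)
    (hprojective : IsSubregularlyProjective G) (hgenerator : IsStrongGeneratorObject G) :
    IsCanonicallyPresenting G where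
  exists_isCopower := hfinite.exists_isCopower
  projective := hprojective
  isSubregularEpi {X P ι} hι ε hε := by
    have hsep : ∀ {X Y : C} {g g' : X ⟶ Y}, (∀ x : G ⟶ X, x ≫ g = x ≫ g') → g = g' := by
      intro X Y g g' h
      obtain ⟨A, c, hc, e, he⟩ := hgenerator.2 X
      rw [← cancel_epi e]
      exact Cofan.IsColimit.hom_ext hc _ _ fun a => by
        simpa only [Category.assoc] using h (c.inj a ≫ e)
    obtain ⟨Z, e, m, he, hm, rfl⟩ :=
      exists_subregular_mono_factorization hprekernel hcoinserter hprojective hsep ε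
    -- An extremal epimorphism from a copower of `G` factorizes through `m`, as `ε` is
    -- surjective on elements at stage `G`; so `m` is invertible.
    obtain ⟨A, c, hc, p, hp⟩ := hgenerator.2 X
    have : IsIso m := hp.isIso
      (Cofan.IsColimit.desc hc fun a => ι (c.inj a ≫ p) ≫ e) m
      (Cofan.IsColimit.hom_ext hc _ _ fun a => by simp [hε])
    obtain ⟨U, u₀, u₁, hu⟩ := he
    exact ⟨U, u₀, u₁, hu.comp_isIso m⟩

namespace IsCanonicallyPresenting

variable {G : C}

/-- The order of morphisms out of `X` is detected on elements at stage `G`. -/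
lemma le_of_forall_comp_le (hG : IsCanonicallyPresenting G) {X Y : C} {g g' : X ⟶ Y}
    (h : ∀ x : G ⟶ X, x ≫ g ≤ x ≫ g') : g ≤ g' := by
  obtain ⟨P, ι, hι⟩ := hG.exists_isCopower (G ⟶ X)
  obtain ⟨ε, hε⟩ := hι.exists_desc fun x => x
  refine (hG.isSubregularEpi hι ε hε).le_of_comp_le (hι.le_of_comp_le fun x => ?_)
  simpa only [← Category.assoc, hε] using h x

/-- A morphism out of the canonical copower descends to `X` as soon as it respects those
inequalities between elements at stage `G` that hold in `X`. -/
lemma exists_desc (hG : IsCanonicallyPresenting G) {X P Y : C} {ι : (G ⟶ X) → (G ⟶ P)}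
    (hι : IsCopower ι) {ε : P ⟶ X} (hε : ∀ x, ι x ≫ ε = x) (f : P ⟶ Y)
    (hf : ∀ y₀ y₁ : G ⟶ P, y₀ ≫ ε ≤ y₁ ≫ ε → y₀ ≫ f ≤ y₁ ≫ f) : ∃ g : X ⟶ Y, ε ≫ g = f := by
  obtain ⟨U, u₀, u₁, hu⟩ := hG.isSubregularEpi hι ε hε
  refine hu.exists_desc f (hG.le_of_forall_comp_le fun x => ?_)
  simpa only [Category.assoc] using
    hf (x ≫ u₀) (x ≫ u₁) (by simpa only [Category.assoc] using comp_le_comp_left x hu.condition)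

/-- A family of morphisms out of a copower of `G`, of any size, has a joint subregular image: impose
on the copower all inequalities between elements at stage `G` that hold in every member of the
family. They are indexed by a small set, a subset of `(G ⟶ P) × (G ⟶ P)`, so they form a parallel
pair out of a copower of `G`; it is reflexive because the trivial inequalities are among them. -/
lemma exists_jointImage (hG : IsCanonicallyPresenting G)
    (hcoinserter : HasReflexiveCoinserters C) {S : Type*} {P : C} {ι : S → (G ⟶ P)}
    (hι : IsCopower ι) {J : Type*} {Z : J → C} (t : ∀ j, P ⟶ Z j) :
    ∃ (L : C) (q : P ⟶ L) (l : ∀ j, L ⟶ Z j), IsSubregularEpi q ∧ (∀ j, q ≫ l j = t j) ∧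
      ∀ y₀ y₁ : G ⟶ P, (∀ j, y₀ ≫ t j ≤ y₁ ≫ t j) → y₀ ≫ q ≤ y₁ ≫ q := by
  obtain ⟨R, κ, hκ⟩ := hG.exists_isCopower
    {y : (G ⟶ P) × (G ⟶ P) // ∀ j, y.1 ≫ t j ≤ y.2 ≫ t j}
  obtain ⟨u₀, hu₀⟩ := hκ.exists_desc fun y => y.1.1
  obtain ⟨u₁, hu₁⟩ := hκ.exists_desc fun y => y.1.2
  obtain ⟨d, hd⟩ := hι.exists_desc fun s => κ ⟨(ι s, ι s), fun _ => le_rfl⟩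
  obtain ⟨L, q, hq⟩ := hcoinserter u₀ u₁ (IsReflexivePair.mk' d
    (hι.hom_ext fun s => by rw [← Category.assoc, hd, hu₀, Category.comp_id])
    (hι.hom_ext fun s => by rw [← Category.assoc, hd, hu₁, Category.comp_id]))
  have hl : ∀ j, ∃ l : L ⟶ Z j, q ≫ l = t j := fun j =>
    hq.exists_desc (t j) (hκ.le_of_comp_le fun y => by
      simpa only [← Category.assoc, hu₀, hu₁] using y.2 j)
  choose l hl using hl
  refine ⟨L, q, l, ⟨R, u₀, u₁, hq⟩, hl, fun y₀ y₁ h => ?_⟩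
  simpa only [← Category.assoc, hu₀, hu₁] using
    comp_le_comp_left (κ ⟨(y₀, y₁), h⟩) hq.condition

end IsCanonicallyPresenting

end

/-! ### Weighted cones and cocones in terms of their legs -/

section

variable {D : Type u₁} [Category.{v₁} D] [PosEnriched D]
  {C : Type u} [Category.{v} C] [PosEnriched C] {F : PosFunctor D C}

section Cocone

variable {W : PosFunctor Dᵒᵖ PartOrd.{v}}

/-- The leg at `d` and `w : W d` of a weighted cocone with vertex `X`. -/
def coconeLeg {X : C} (α : W ⟶ F.nerve.obj X) (d : D) (w : W.obj (op d)) : F.obj d ⟶ X :=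
  (α.app (op d)).hom w

lemma coconeLeg_mono {X : C} (α : W ⟶ F.nerve.obj X) (d : D) {w w' : W.obj (op d)}
    (h : w ≤ w') : coconeLeg α d w ≤ coconeLeg α d w' :=
  (α.app (op d)).hom.monotone h

lemma coconeLeg_naturality {X : C} (α : W ⟶ F.nerve.obj X) {d d' : D} (k : d ⟶ d')
    (w : W.obj (op d')) :
    coconeLeg α d ((W.map k.op).hom w) = F.map k ≫ coconeLeg α d' w :=
  DFunLike.congr_fun (congrArg PartOrd.Hom.hom (α.naturality k.op)) w

lemma coconeLeg_ext {X : C} {α β : W ⟶ F.nerve.obj X}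
    (h : ∀ d w, coconeLeg α d w = coconeLeg β d w) : α = β :=
  NatTrans.ext (funext fun d => PartOrd.ext fun w => h d.unop w)

lemma exists_cocone {X : C} (l : ∀ d : D, W.obj (op d) → (F.obj d ⟶ X))
    (hmono : ∀ d w w', w ≤ w' → l d w ≤ l d w')
    (hnat : ∀ {d d' : D} (k : d ⟶ d') (w : W.obj (op d')),
      l d ((W.map k.op).hom w) = F.map k ≫ l d' w) :
    ∃ α : W ⟶ F.nerve.obj X, ∀ d w, coconeLeg α d w = l d w :=
  ⟨{ app := fun d => PartOrd.ofHom ⟨l d.unop, fun _ _ h => hmono _ _ _ h⟩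
     naturality := fun _ _ k => PartOrd.ext fun w => hnat k.unop w }, fun _ _ => rfl⟩

/-- A weighted colimit, given by a universal weighted cocone. -/
lemma nonempty_weightedColimit {L : C} (l : W ⟶ F.nerve.obj L)
    (hdesc : ∀ {X : C} (α : W ⟶ F.nerve.obj X), ∃ g : L ⟶ X,
      ∀ d w, coconeLeg l d w ≫ g = coconeLeg α d w)
    (hle : ∀ {X : C} {g g' : L ⟶ X},
      (∀ d w, coconeLeg l d w ≫ g ≤ coconeLeg l d w ≫ g') → g ≤ g') :
    Nonempty (WeightedColimit F W) := by
  have hle' : ∀ {X : C} {g g' : L ⟶ X}, l ≫ F.nerve.map g ≤ l ≫ F.nerve.map g' → g ≤ g' :=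
    fun h => hle fun d w => h (op d) w
  refine ⟨⟨L, fun X => ⟨Equiv.ofBijective (fun g : L ⟶ X => l ≫ F.nerve.map g)
    ⟨fun g g' h => le_antisymm (hle' h.le) (hle' h.ge), fun α => ?_⟩,
    ⟨hle', fun h => comp_le_comp_left l (F.nerve.map_mono h)⟩⟩, fun f h => ?_⟩⟩
  · obtain ⟨g, hg⟩ := hdesc α
    exact ⟨g, coconeLeg_ext hg⟩
  · exact (congrArg (l ≫ ·) (F.nerve.map_comp f h)).trans (Category.assoc _ _ _).symm

end Cocone

section Cone

variable {W : PosFunctor D PartOrd.{v}}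

/-- The leg at `d` and `w : W d` of a weighted cone with vertex `X`. -/
def coneLeg {X : C} (α : W ⟶ F.conerve.obj (op X)) (d : D) (w : W.obj d) : X ⟶ F.obj d :=
  (α.app d).hom w

lemma coneLeg_mono {X : C} (α : W ⟶ F.conerve.obj (op X)) (d : D) {w w' : W.obj d}
    (h : w ≤ w') : coneLeg α d w ≤ coneLeg α d w' :=
  (α.app d).hom.monotone h

lemma coneLeg_naturality {X : C} (α : W ⟶ F.conerve.obj (op X)) {d d' : D} (k : d ⟶ d')
    (w : W.obj d) : coneLeg α d' ((W.map k).hom w) = coneLeg α d w ≫ F.map k :=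
  DFunLike.congr_fun (congrArg PartOrd.Hom.hom (α.naturality k)) w

lemma coneLeg_ext {X : C} {α β : W ⟶ F.conerve.obj (op X)}
    (h : ∀ d w, coneLeg α d w = coneLeg β d w) : α = β :=
  NatTrans.ext (funext fun d => PartOrd.ext fun w => h d w)

lemma coneLeg_comp {X Y : C} (α : W ⟶ F.conerve.obj (op X)) (g : Y ⟶ X) (d : D) (w : W.obj d) :
    coneLeg (α ≫ F.conerve.map g.op) d w = g ≫ coneLeg α d w :=
  rfl

lemma exists_cone {X : C} (l : ∀ d : D, W.obj d → (X ⟶ F.obj d))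
    (hmono : ∀ d w w', w ≤ w' → l d w ≤ l d w')
    (hnat : ∀ {d d' : D} (k : d ⟶ d') (w : W.obj d), l d' ((W.map k).hom w) = l d w ≫ F.map k) :
    ∃ α : W ⟶ F.conerve.obj (op X), ∀ d w, coneLeg α d w = l d w :=
  ⟨{ app := fun d => PartOrd.ofHom ⟨l d, fun _ _ h => hmono _ _ _ h⟩
     naturality := fun _ _ k => PartOrd.ext fun w => hnat k w }, fun _ _ => rfl⟩

/-- A weighted limit, given by a universal weighted cone. -/
lemma nonempty_weightedLimit {L : C} (l : W ⟶ F.conerve.obj (op L))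
    (hlift : ∀ {X : C} (α : W ⟶ F.conerve.obj (op X)), ∃ g : X ⟶ L,
      ∀ d w, g ≫ coneLeg l d w = coneLeg α d w)
    (hle : ∀ {X : C} {g g' : X ⟶ L},
      (∀ d w, g ≫ coneLeg l d w ≤ g' ≫ coneLeg l d w) → g ≤ g') :
    Nonempty (WeightedLimit F W) := by
  have hle' : ∀ {X : C} {g g' : X ⟶ L},
      l ≫ F.conerve.map (Quiver.Hom.op g) ≤ l ≫ F.conerve.map (Quiver.Hom.op g') → g ≤ g' :=
    fun h => hle fun d w => h d w
  refine ⟨⟨L, fun X => ⟨Equiv.ofBijective (fun g : X ⟶ L => l ≫ F.conerve.map g.op)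
    ⟨fun g g' h => le_antisymm (hle' h.le) (hle' h.ge), fun α => ?_⟩,
    fun {g g'} => ⟨hle', fun h =>
      comp_le_comp_left l (F.conerve.map_mono (f := Quiver.Hom.op g) (g := Quiver.Hom.op g') h)⟩⟩,
    fun f h => ?_⟩⟩
  · obtain ⟨g, hg⟩ := hlift α
    exact ⟨g, coneLeg_ext hg⟩
  · exact (congrArg (l ≫ ·) (F.conerve.map_comp f.op h.op)).trans (Category.assoc _ _ _).symm

end Cone

end

/-! ### Existence of weighted limits and colimits -/

section

variable {C : Type u} [Category.{v} C] [PosEnriched C]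

/-- The limit is the joint subregular image of the projections from the copower of `G` indexed by
the weighted cones with vertex `G`, which are to be the elements of the limit at stage `G`. -/
theorem hasWeightedLimits {G : C} (hG : IsCanonicallyPresenting G)
    (hcoinserter : HasReflexiveCoinserters C) : HasWeightedLimits C := by
  intro D _ _ F W
  obtain ⟨P, ι, hι⟩ := hG.exists_isCopower (W ⟶ F.conerve.obj (op G))
  have ht : ∀ j : Σ d : D, W.obj d, ∃ t : P ⟶ F.obj j.1, ∀ σ : W ⟶ F.conerve.obj (op G),
      ι σ ≫ t = coneLeg σ j.1 j.2 :=
    fun j => hι.exists_desc _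
  choose t ht using ht
  obtain ⟨L, q, l, hq, hl, hqle⟩ := hG.exists_jointImage hcoinserter hι t
  obtain ⟨lam, hlam⟩ := exists_cone (F := F) (W := W) (fun d w => l ⟨d, w⟩)
    (fun d w w' hw => hq.le_of_comp_le (hι.le_of_comp_le fun σ => by
      rw [hl, hl, ht, ht]
      exact coneLeg_mono σ d hw))
    (fun {d d'} k w => by
      have h : q ≫ l ⟨d', (W.map k).hom w⟩ = q ≫ l ⟨d, w⟩ ≫ F.map k := hι.hom_ext fun σ => by
        rw [← Category.assoc q, hl, hl, ht, ← Category.assoc, ht]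
        exact coneLeg_naturality σ k w
      exact le_antisymm (hq.le_of_comp_le h.le) (hq.le_of_comp_le h.ge))
  refine nonempty_weightedLimit lam (fun {X} α => ?_) (fun {X g g'} h => ?_)
  · -- At stage `G`, the factorization sends `x : G ⟶ X` to the class of the cone `x ≫ α`.
    obtain ⟨Q, κ, hκ⟩ := hG.exists_isCopower (G ⟶ X)
    obtain ⟨ε, hε⟩ := hκ.exists_desc fun x => x
    obtain ⟨h, hh⟩ := hκ.exists_desc fun x => ι (α ≫ F.conerve.map x.op)
    have hht : ∀ d w, h ≫ t ⟨d, w⟩ = ε ≫ coneLeg α d w := fun d w => hκ.hom_ext fun x => by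
      rw [← Category.assoc, hh, ht, ← Category.assoc, hε, coneLeg_comp]
    obtain ⟨g, hg⟩ := hG.exists_desc hκ hε (h ≫ q) fun y₀ y₁ hy => by
      rw [← Category.assoc, ← Category.assoc]
      refine hqle _ _ fun j => ?_
      rw [Category.assoc, Category.assoc, hht, ← Category.assoc, ← Category.assoc]
      exact comp_le_comp_right hy _
    have key : ∀ d w, ε ≫ g ≫ l ⟨d, w⟩ = ε ≫ coneLeg α d w := fun d w => by
      rw [← Category.assoc, hg, Category.assoc, hl, hht]
    have hεepi := hG.isSubregularEpi hκ ε hε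
    exact ⟨g, fun d w => by
      rw [hlam]
      exact le_antisymm (hεepi.le_of_comp_le (key d w).le) (hεepi.le_of_comp_le (key d w).ge)⟩
  · refine hG.le_of_forall_comp_le fun x => ?_
    obtain ⟨y₀, hy₀⟩ := hG.projective q hq (x ≫ g)
    obtain ⟨y₁, hy₁⟩ := hG.projective q hq (x ≫ g')
    rw [← hy₀, ← hy₁]
    refine hqle _ _ fun j => ?_
    rw [← hl, ← Category.assoc, ← Category.assoc, hy₀, hy₁, Category.assoc, Category.assoc]
    simpa only [hlam] using comp_le_comp_left x (h j.1 j.2)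

/-- The colimit is the joint subregular image of all weighted cocones, regarded as morphisms out of
the copower of `G` indexed by the triples of an object `d`, an element of `W d`, and a morphism
`G ⟶ F d`. -/
theorem nonempty_weightedColimit_of_small {G : C} (hG : IsCanonicallyPresenting G)
    (hcoinserter : HasReflexiveCoinserters C) {D : Type u₁} [Category.{v₁} D] [PosEnriched D]
    [Small.{v} D] (F : PosFunctor D C) (W : PosFunctor Dᵒᵖ PartOrd.{v}) :
    Nonempty (WeightedColimit F W) := by
  obtain ⟨P, ι, hι⟩ := exists_isCopower_of_small hG.exists_isCopower
    (Σ d : D, W.obj (op d) × (G ⟶ F.obj d))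
  have ht : ∀ j : Σ X : C, (W ⟶ F.nerve.obj X), ∃ t : P ⟶ j.1, ∀ s,
      ι s ≫ t = s.2.2 ≫ coconeLeg j.2 s.1 s.2.1 :=
    fun j => hι.exists_desc _
  choose t ht using ht
  obtain ⟨L, q, l, hq, hl, hqle⟩ := hG.exists_jointImage hcoinserter hι t
  -- The leg of the universal cocone at `d` and `w` sends `x : G ⟶ F d` to the injection at
  -- `(d, w, x)`.
  have hleg : ∀ (d : D) (w : W.obj (op d)), ∃ g : F.obj d ⟶ L,
      ∀ x : G ⟶ F.obj d, x ≫ g = ι ⟨d, w, x⟩ ≫ q := fun d w => by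
    obtain ⟨Q, κ, hκ⟩ := hG.exists_isCopower (G ⟶ F.obj d)
    obtain ⟨ε, hε⟩ := hκ.exists_desc fun x => x
    obtain ⟨h, hh⟩ := hκ.exists_desc fun x => ι ⟨d, w, x⟩
    have hht : ∀ j, h ≫ t j = ε ≫ coconeLeg j.2 d w := fun j => hκ.hom_ext fun x => by
      rw [← Category.assoc, hh, ht, ← Category.assoc, hε]
    obtain ⟨g, hg⟩ := hG.exists_desc hκ hε (h ≫ q) fun y₀ y₁ hy => by
      rw [← Category.assoc, ← Category.assoc]
      refine hqle _ _ fun j => ?_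
      rw [Category.assoc, Category.assoc, hht, ← Category.assoc, ← Category.assoc]
      exact comp_le_comp_right hy _
    exact ⟨g, fun x => by rw [← hh, Category.assoc, ← hg, ← Category.assoc, hε]⟩
  choose leg hleg using hleg
  obtain ⟨lam, hlam⟩ := exists_cocone (F := F) (W := W) leg
    (fun d w w' hw => hG.le_of_forall_comp_le fun x => by
      rw [hleg, hleg]
      refine hqle _ _ fun j => ?_
      rw [ht, ht]
      exact comp_le_comp_left x (coconeLeg_mono j.2 d hw))
    (fun {d d'} k w => by
      have h : ∀ x j, ι ⟨d, (W.map k.op).hom w, x⟩ ≫ t j = ι ⟨d', w, x ≫ F.map k⟩ ≫ t j :=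
        fun x j => by
          rw [ht, ht, Category.assoc]
          exact congrArg (x ≫ ·) (coconeLeg_naturality j.2 k w)
      refine le_antisymm (hG.le_of_forall_comp_le fun x => ?_)
        (hG.le_of_forall_comp_le fun x => ?_)
      all_goals
        rw [← Category.assoc, hleg, hleg]
      · exact hqle _ _ fun j => (h x j).le
      · exact hqle _ _ fun j => (h x j).ge)
  refine nonempty_weightedColimit lam (fun {X} α => ⟨l ⟨X, α⟩, fun d w => ?_⟩)
    (fun {X g g'} h => ?_)
  · have key : ∀ x, x ≫ leg d w ≫ l ⟨X, α⟩ = x ≫ coconeLeg α d w := fun x => by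
      rw [← Category.assoc, hleg, Category.assoc, hl, ht]
    rw [hlam]
    exact le_antisymm (hG.le_of_forall_comp_le fun x => (key x).le)
      (hG.le_of_forall_comp_le fun x => (key x).ge)
  · refine hq.le_of_comp_le (hι.le_of_comp_le fun ⟨d, w, x⟩ => ?_)
    rw [← Category.assoc, ← Category.assoc, ← hleg, Category.assoc, Category.assoc]
    simpa only [hlam] using comp_le_comp_left x (h d w)

theorem hasWeightedColimits {G : C} (hG : IsCanonicallyPresenting G)
    (hcoinserter : HasReflexiveCoinserters C) : HasWeightedColimits C :=
  fun _ _ _ F W => nonempty_weightedColimit_of_small hG hcoinserter F W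

/-! ### The nerve of the finite copowers -/

/-- The left adjoint of the nerve sends a presheaf `Y` to the colimit of `F` weighted by `Y`. -/
lemma PosFunctor.hasLeftAdjoint_nerve {D : Type u₁} [Category.{v₁} D] [PosEnriched D]
    (F : PosFunctor D C) (h : ∀ W, Nonempty (WeightedColimit F W)) : F.nerve.HasLeftAdjoint := by
  let L (W) := (h W).some
  have hnat : ∀ {W X} (f : (L W).pt ⟶ X),
      (L W).iso X f = (L W).iso _ (𝟙 _) ≫ F.nerve.map f := fun {W X} f => by
    rw [← (L W).natural, Category.id_comp]
  have hmap : ∀ {W W'} (k : W' ⟶ W) {X : C} (f : (L W).pt ⟶ X),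
      (L W').iso X (((L W').iso _).symm (k ≫ (L W).iso _ (𝟙 _)) ≫ f) = k ≫ (L W).iso X f :=
    fun {W W'} k {X} f => by
      rw [(L W').natural, OrderIso.apply_symm_apply, Category.assoc, ← hnat]
  refine ⟨{ obj := fun W => (L W).pt
            map := fun {W' W} k => ((L W').iso _).symm (k ≫ (L W).iso _ (𝟙 _))
            map_id := fun W => by rw [Category.id_comp, OrderIso.symm_apply_apply]
            map_comp := fun {W W' W''} k k' => ?_
            map_mono := fun {W W' k k'} hk => ?_ },
          fun W X => (L W).iso X, fun W X X' f g => (L W).natural f g,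
          fun W W' X k f => hmap k f⟩
  · apply ((L W).iso _).injective
    rw [hmap, OrderIso.apply_symm_apply, OrderIso.apply_symm_apply, Category.assoc]
  · exact ((L W).iso _).symm.monotone (comp_le_comp_right hk _)

section

variable {G : C} {T : ℕ → C} {κ : ∀ n, Fin n → (G ⟶ T n)} {X Y : C}

/-- The component at the `n`-th finite copower of a transformation between nerves. -/
def nerveComponent (θ : (PosFunctor.inclusion T).nerve.obj X ⟶ (PosFunctor.inclusion T).nerve.obj Y)
    (n : ℕ) (x : T n ⟶ X) : T n ⟶ Y :=
  (θ.app (op (n : InducedCategory C T))).hom x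

lemma nerveComponent_mono
    (θ : (PosFunctor.inclusion T).nerve.obj X ⟶ (PosFunctor.inclusion T).nerve.obj Y) (n : ℕ)
    {x x' : T n ⟶ X} (h : x ≤ x') : nerveComponent θ n x ≤ nerveComponent θ n x' :=
  (θ.app (op (n : InducedCategory C T))).hom.monotone h

lemma nerveComponent_naturality
    (θ : (PosFunctor.inclusion T).nerve.obj X ⟶ (PosFunctor.inclusion T).nerve.obj Y) {n m : ℕ}
    (k : T n ⟶ T m) (x : T m ⟶ X) :
    nerveComponent θ n (k ≫ x) = k ≫ nerveComponent θ m x :=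
  DFunLike.congr_fun (congrArg PartOrd.Hom.hom (θ.naturality
    (InducedCategory.homMk (F := T) (X := n) (Y := m) k).op)) x

/-- The nerve of the finite copowers is full. A transformation restricts to a map from the elements
of `X` to the elements of `Y`, at stage `G`, that is monotone and commutes with all finitary
operations `G ⟶ T n`. By finiteness it respects all inequalities in the canonical presentation of
`X`, and so it is induced by a morphism. -/
lemma exists_nerve_map_eq (hG : IsCanonicallyPresenting G) (hfinite : IsAbstractlyFinite G)
    (hκ : ∀ n, IsCopower (κ n))
    (θ : (PosFunctor.inclusion T).nerve.obj X ⟶ (PosFunctor.inclusion T).nerve.obj Y) :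
    ∃ f : X ⟶ Y, (PosFunctor.inclusion T).nerve.map f = θ := by
  choose p hp using fun x : G ⟶ X => (hκ 1).exists_desc fun _ => x
  let φ (x : G ⟶ X) : G ⟶ Y := κ 1 0 ≫ nerveComponent θ 1 (p x)
  have hφ : ∀ {n} (z : G ⟶ T n) (x : T n ⟶ X), φ (z ≫ x) = z ≫ nerveComponent θ n x := by
    intro n z x
    obtain ⟨k, hk⟩ := (hκ 1).exists_desc fun _ => z
    have : p (z ≫ x) = k ≫ x := (hκ 1).hom_ext fun i => by rw [hp, ← Category.assoc, hk]
    simp only [φ]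
    rw [this, nerveComponent_naturality, ← Category.assoc, hk]
  have hφmono : ∀ {x x'}, x ≤ x' → φ x ≤ φ x' := fun {x x'} h =>
    comp_le_comp_left _ (nerveComponent_mono θ 1 ((hκ 1).le_of_comp_le fun i => by
      rwa [hp, hp]))
  obtain ⟨P, ι, hι, hfin⟩ := hfinite.exists_isCopower_finite (G ⟶ X)
  obtain ⟨ε, hε⟩ := hι.exists_desc fun x => x
  obtain ⟨h, hh⟩ := hι.exists_desc φ
  have hy : ∀ y : G ⟶ P, y ≫ h = φ (y ≫ ε) := by
    intro y
    obtain ⟨n, s, Q, ρ, z, m, hρ, rfl, hm⟩ := hfin y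
    obtain ⟨r, hr⟩ := hρ.exists_desc (κ n)
    obtain ⟨r', hr'⟩ := (hκ n).exists_desc fun i => ι (s i)
    have hrr : r ≫ r' = m := hρ.hom_ext fun i => by rw [← Category.assoc, hr, hr', hm]
    have : r' ≫ h = nerveComponent θ n (r' ≫ ε) := (hκ n).hom_ext fun i => by
      rw [← hφ, ← Category.assoc, ← Category.assoc, hr', hh, hε]
    rw [← hrr]
    simp only [Category.assoc]
    rw [this, ← Category.assoc, ← Category.assoc, ← hφ, Category.assoc]
  obtain ⟨f, hf⟩ := hG.exists_desc hι hε h fun y₀ y₁ hle => by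
    rw [hy, hy]
    exact hφmono hle
  have hxf : ∀ x : G ⟶ X, x ≫ f = φ x := fun x => by
    rw [← hh, ← hf, ← Category.assoc, hε]
  have key : ∀ n (x : T n ⟶ X), x ≫ f = nerveComponent θ n x := fun n x =>
    (hκ n).hom_ext fun i => by rw [← Category.assoc, hxf, hφ]
  exact ⟨f, NatTrans.ext (funext fun n => PartOrd.ext fun x => key n.unop x)⟩

theorem isFullyFaithful_nerve (hG : IsCanonicallyPresenting G) (hfinite : IsAbstractlyFinite G)
    (hκ : ∀ n, IsCopower (κ n)) : (PosFunctor.inclusion T).nerve.IsFullyFaithful := by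
  have reflect : ∀ {X Y : C} (f g : X ⟶ Y),
      (PosFunctor.inclusion T).nerve.map f ≤ (PosFunctor.inclusion T).nerve.map g → f ≤ g := by
    intro X Y f g h
    refine hG.le_of_forall_comp_le fun x => ?_
    obtain ⟨p, hp⟩ := (hκ 1).exists_desc fun _ => x
    have : p ≫ f ≤ p ≫ g := h (op (1 : ℕ)) p
    simpa only [← Category.assoc, hp] using comp_le_comp_left (κ 1 0) this
  exact fun X Y => ⟨⟨fun f g h => le_antisymm (reflect f g h.le) (reflect g f h.ge),
    exists_nerve_map_eq hG hfinite hκ⟩, reflect⟩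

end

end

theorem proposition3p19 {K : Type u} [Category.{v} K] [PosEnriched K]
    (hprekernel : HasPrekernelPairs K) (hcoinserter : HasReflexiveCoinserters K)
    (G : K) (hfinite : IsAbstractlyFinite G) (hprojective : IsSubregularlyProjective G)
    (hgenerator : IsStrongGeneratorObject G) :
    HasWeightedLimits K ∧ HasWeightedColimits K ∧
      ∀ (c : ∀ n : ℕ, Cofan (fun _ : Fin n => G)), (∀ n, Nonempty (IsColimit (c n))) →
        (PosFunctor.inclusion (fun n : ℕ => (c n).pt)).nerve.IsFullyFaithful ∧
        (PosFunctor.inclusion (fun n : ℕ => (c n).pt)).nerve.HasLeftAdjoint := by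
  have hG := isCanonicallyPresenting hprekernel hcoinserter hfinite hprojective hgenerator
  refine ⟨hasWeightedLimits hG hcoinserter, hasWeightedColimits hG hcoinserter, fun c hc =>
    ⟨isFullyFaithful_nerve hG hfinite fun n =>
      isCopower_of_isColimit hG.exists_isCopower (hc n).some,
    PosFunctor.hasLeftAdjoint_nerve _ fun W => ?_⟩⟩
  have : Small.{v} (InducedCategory K fun n : ℕ => (c n).pt) := inferInstanceAs (Small.{v} ℕ)
  exact nonempty_weightedColimit_of_small hG hcoinserter _ W
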